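/- Let $\mathbb S^4=\{\xi\in\mathbb R^5:|\xi|=1\}$ carry its round metric with Laplace–Beltrami operator $\Delta$, let $dw$ be the surface measure of $\mathbb S^4$ normalized so that $\int_{\mathbb S^4}dw=1$, and let $P_4=\Delta^2-2\Delta$ be the Paneitz operator. Let $\alpha>0$ with $\alpha\neq1$, and let $u\in C^4(\mathbb S^4)$ be a real-valued (not necessarily axially symmetric) solution of $$\alpha P_4u+6\left(1-\frac{e^{4u}}{\int_{\mathbb S^4}e^{4u}\,dw}\right)=0\quad\text{on }\mathbb S^4 .$$ Then $$\int_{\mathbb S^4}e^{4u}\,\xi_i\,dw=0\quad\text{and}\quad\int_{\mathbb S^4}u\,\xi_i\,dw=0,\qquad i=1,\dots,5,$$ where $\xi_1,\dots,\xi_5$ are the coordinate functions of $\mathbb R^5$ restricted to $\mathbb S^4$. -/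

import Mathlib

noncomputable section

/-- The ambient Euclidean space `ℝ⁵`. -/
abbrev R5 : Type := EuclideanSpace ℝ (Fin 5)

/-- The unit sphere `𝕊⁴ ⊆ ℝ⁵`, with its standard structure of a smooth manifold. -/
abbrev S4 : Type := Metric.sphere (0 : R5) 1

/-- The extension of a function on `𝕊⁴` to `ℝ⁵ ∖ {0}` that is constant along rays,
`x ↦ f (x / ‖x‖)` (with the irrelevant value `0` at the origin). -/
def radialExtension (f : S4 → ℝ) (x : R5) : ℝ :=
  if h : x = 0 then 0
  else f ⟨‖x‖⁻¹ • x, by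
    have hx : ‖x‖ ≠ 0 := norm_ne_zero_iff.mpr h
    simp [norm_smul, hx]⟩

/-- The Laplace–Beltrami operator of the round sphere `𝕊⁴` (nonpositive sign convention):
the Euclidean Laplacian of the extension that is constant along rays, restricted to `𝕊⁴`. -/
def sphereLaplacian (f : S4 → ℝ) (ξ : S4) : ℝ :=
  (Laplacian.laplacian (radialExtension f) : R5 → ℝ) (ξ : R5)

/-- The Paneitz operator `P₄ = Δ² - 2 Δ` on `𝕊⁴`. -/
def paneitz (f : S4 → ℝ) (ξ : S4) : ℝ :=
  sphereLaplacian (sphereLaplacian f) ξ - 2 * sphereLaplacian f ξ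

/-- The surface measure `dw` of `𝕊⁴`, normalized to total mass `1`. -/
def sphereMeasure : MeasureTheory.Measure S4 :=
  ((MeasureTheory.volume : MeasureTheory.Measure R5).toSphere Set.univ)⁻¹ •
    (MeasureTheory.volume : MeasureTheory.Measure R5).toSphere

/-- `u` is a (classical) solution of
`α P₄ u + 6 (1 - e^{4u} / ∫ e^{4u} dw) = 0` on `𝕊⁴`: it is of class `C⁴` and the equation holds
at every point. -/
structure IsQCurvatureSolution (α : ℝ) (u : S4 → ℝ) : Prop where
  contMDiff : ContMDiff (modelWithCornersSelf ℝ (EuclideanSpace ℝ (Fin 4)))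
    (modelWithCornersSelf ℝ ℝ) 4 u
  equation : ∀ ξ : S4,
    α * paneitz u ξ
      + 6 * (1 - Real.exp (4 * u ξ) / ∫ η, Real.exp (4 * u η) ∂sphereMeasure) = 0

end

open Set MeasureTheory
open scoped Manifold ContDiff

/-! This is a Kazdan–Warner argument. Let X_i = ∇ξ_i (`coordGrad i`), a conformal field with div X_i
= -4ξ_i, so ∫ X_i f = 4 ∫ ξ_i f (`integral_coordGrad`).

Testing the equation against X_i u kills the Paneitz term (`integral_paneitz_mul_coordGrad`). Since
e^{4u} X_i u = X_i(e^{4u})/4, what remains, with I = ∫ e^{4u}, is 24 ∫ u ξ_i = (6/I) ∫ e^{4u} ξ_i.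
Testing against ξ_i, which satisfies P₄ ξ_i = 24 ξ_i and has mean zero, gives 24α ∫ u ξ_i = (6/I) ∫
e^{4u} ξ_i. As α ≠ 1, both integrals vanish.

Analysis on the sphere is done in ℝ⁵ through extensions homogeneous of degree 0; the divergence
theorem comes from Euclidean integration by parts against a radial cutoff. -/

theorem radialExtension_coe (f : S4 → ℝ) (ξ : S4) : radialExtension f (ξ : R5) = f ξ := by
  have hξ : ‖(ξ : R5)‖ = 1 := by simp
  have h0 : (ξ : R5) ≠ 0 := by
    intro h; simp [h] at hξ
  rw [radialExtension, dif_neg h0]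
  congr 1
  ext1
  simp [hξ]

theorem radialExtension_smul (f : S4 → ℝ) {c : ℝ} (hc : 0 < c) (y : R5) :
    radialExtension f (c • y) = radialExtension f y := by
  by_cases hy : y = 0
  · simp [hy]
  · rw [radialExtension, dif_neg (by simp [hc.ne', hy]), radialExtension, dif_neg hy]
    congr 1
    ext1
    simp only [norm_smul, Real.norm_eq_abs, abs_of_pos hc, smul_smul, mul_inv]
    congr 1
    field_simp

/-- Every nonzero vector is a positive multiple of a point of the sphere. -/
theorem exists_eq_smul_coe {y : R5} (hy : y ≠ 0) : ∃ ξ : S4, y = ‖y‖ • (ξ : R5) := by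
  have h : ‖y‖ ≠ 0 := norm_ne_zero_iff.mpr hy
  exact ⟨⟨‖y‖⁻¹ • y, by simp [norm_smul, h]⟩, by simp [smul_smul, h]⟩

theorem norm_coe_S4 (ξ : S4) : ‖(ξ : R5)‖ = 1 := by simp

theorem coe_S4_ne_zero (ξ : S4) : (ξ : R5) ≠ 0 := by
  intro h
  have := norm_coe_S4 ξ
  simp [h] at this

/-! ### Smoothness on the sphere through radial extensions -/

/-- `f` is of class `C^n` on the sphere: its radial extension is `C^n` off the origin. -/
def SphereContDiff (n : ℕ∞ω) (f : S4 → ℝ) : Prop := ContDiffOn ℝ n (radialExtension f) {0}ᶜ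

theorem ContMDiff.sphereContDiff {n : ℕ∞ω} {f : S4 → ℝ} (hf : ContMDiff (𝓡 4) 𝓘(ℝ, ℝ) n f) :
    SphereContDiff n f := by
  let U : TopologicalSpace.Opens R5 := ⟨{0}ᶜ, isOpen_compl_singleton⟩
  let p : U → R5 := fun y => ‖(y : R5)‖⁻¹ • (y : R5)
  have hp' : ∀ y : U, p y ∈ Metric.sphere (0 : R5) 1 := by
    rintro ⟨y, hy⟩
    have : ‖y‖ ≠ 0 := norm_ne_zero_iff.mpr hy
    simp [p, norm_smul, this]
  have hp : ContMDiff 𝓘(ℝ, R5) 𝓘(ℝ, R5) n p := by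
    intro y
    have hy : (y : R5) ≠ 0 := y.2
    have : ContMDiffAt 𝓘(ℝ, R5) 𝓘(ℝ, R5) n (fun z : R5 => ‖z‖⁻¹ • z) (y : R5) := by
      apply ContDiffAt.contMDiffAt
      exact ((contDiffAt_norm ℝ hy).inv (norm_ne_zero_iff.mpr hy)).smul contDiffAt_id
    exact contMDiffAt_subtype_iff.mpr this
  have : Fact (Module.finrank ℝ R5 = 4 + 1) := ⟨finrank_euclideanSpace_fin⟩
  have h := hf.comp (hp.codRestrict_sphere hp')
  intro y hy
  apply ContDiffAt.contDiffWithinAt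
  rw [← contMDiffAt_iff_contDiffAt]
  rw [← contMDiffAt_subtype_iff (U := U) (x := ⟨y, hy⟩)]
  convert h ⟨y, hy⟩ using 1
  ext ⟨z, hz⟩
  have hz' : z ≠ 0 := hz
  simp [radialExtension, hz']
  rfl

namespace SphereContDiff

variable {n m : ℕ∞ω} {f g : S4 → ℝ}

theorem mono (hf : SphereContDiff n f) (h : m ≤ n) : SphereContDiff m f := ContDiffOn.of_le hf h

theorem contDiffAt (hf : SphereContDiff n f) {y : R5} (hy : y ≠ 0) :
    ContDiffAt ℝ n (radialExtension f) y :=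
  ContDiffOn.contDiffAt hf (isOpen_compl_singleton.mem_nhds hy)

theorem differentiableAt (hf : SphereContDiff 1 f) {y : R5} (hy : y ≠ 0) :
    DifferentiableAt ℝ (radialExtension f) y :=
  (hf.contDiffAt hy).differentiableAt one_ne_zero

theorem continuous (hf : SphereContDiff n f) : Continuous f := by
  have : f = fun ξ : S4 => radialExtension f (ξ : R5) := by
    ext ξ; rw [radialExtension_coe]
  rw [this]
  exact (ContDiffOn.continuousOn hf).comp_continuous continuous_subtype_val coe_S4_ne_zero

end SphereContDiff

theorem radialExtension_eq_of_smul {f : S4 → ℝ} {F : R5 → ℝ} (h : ∀ ξ : S4, f ξ = F ξ)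
    (hF : ∀ c : ℝ, 0 < c → ∀ y : R5, y ≠ 0 → F (c • y) = F y) {y : R5} (hy : y ≠ 0) :
    radialExtension f y = F y := by
  obtain ⟨ξ, hξ⟩ := exists_eq_smul_coe hy
  have h0 : 0 < ‖y‖ := norm_pos_iff.mpr hy
  rw [hξ, radialExtension_smul _ h0, radialExtension_coe, hF _ h0 _ (coe_S4_ne_zero ξ), h]

theorem radialExtension_add (f g : S4 → ℝ) :
    radialExtension (fun ξ => f ξ + g ξ) = fun y => radialExtension f y + radialExtension g y := by
  ext y
  by_cases hy : y = 0 <;> simp [radialExtension, hy]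

theorem radialExtension_mul (f g : S4 → ℝ) :
    radialExtension (fun ξ => f ξ * g ξ) = fun y => radialExtension f y * radialExtension g y := by
  ext y
  by_cases hy : y = 0 <;> simp [radialExtension, hy]

theorem radialExtension_comp (φ : ℝ → ℝ) (f : S4 → ℝ) {y : R5} (hy : y ≠ 0) :
    radialExtension (fun ξ => φ (f ξ)) y = φ (radialExtension f y) := by
  simp [radialExtension, hy]

theorem radialExtension_coord (i : Fin 5) {y : R5} (hy : y ≠ 0) :
    radialExtension (fun ξ => (ξ : R5) i) y = ‖y‖⁻¹ * y i := by
  simp [radialExtension, hy]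

/-! ### Calculus of the fields `coordGrad i` -/

/-- The derivative of `f` along the tangential part of the `i`-th coordinate vector, that is,
along the gradient of the `i`-th coordinate function. -/
noncomputable def coordGrad (i : Fin 5) (f : S4 → ℝ) (ξ : S4) : ℝ :=
  fderiv ℝ (radialExtension f) (ξ : R5) (EuclideanSpace.single i 1)

theorem fderiv_radialExtension_smul (f : S4 → ℝ) {c : ℝ} (hc : 0 < c) (y : R5) :
    c • fderiv ℝ (radialExtension f) (c • y) = fderiv ℝ (radialExtension f) y := by
  rw [← fderiv_comp_smul]
  congr 1
  ext z
  exact radialExtension_smul f hc z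

/-- Partial derivatives of a degree-0 function have degree -1; the factor `‖y‖` restores degree 0,
so that `coordGrad` can be iterated. -/
theorem radialExtension_coordGrad (i : Fin 5) (f : S4 → ℝ) {y : R5} (hy : y ≠ 0) :
    radialExtension (coordGrad i f) y =
      ‖y‖ * fderiv ℝ (radialExtension f) y (EuclideanSpace.single i 1) := by
  apply radialExtension_eq_of_smul (F := fun y =>
    ‖y‖ * fderiv ℝ (radialExtension f) y (EuclideanSpace.single i 1)) _ _ hy
  · intro ξ
    simp [coordGrad]
  · intro c hc z hz
    rw [← fderiv_radialExtension_smul f hc z]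
    simp only [norm_smul, Real.norm_eq_abs, abs_of_pos hc, smul_apply,
      smul_eq_mul]
    ring

namespace SphereContDiff

variable {n m : ℕ∞ω} {f g : S4 → ℝ}

theorem add (hf : SphereContDiff n f) (hg : SphereContDiff n g) :
    SphereContDiff n (fun ξ => f ξ + g ξ) := by
  rw [SphereContDiff, radialExtension_add]
  exact ContDiffOn.add hf hg

theorem mul (hf : SphereContDiff n f) (hg : SphereContDiff n g) :
    SphereContDiff n (fun ξ => f ξ * g ξ) := by
  rw [SphereContDiff, radialExtension_mul]
  exact ContDiffOn.mul hf hg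

theorem comp {φ : ℝ → ℝ} (hf : SphereContDiff n f) (hφ : ContDiff ℝ n φ) :
    SphereContDiff n (fun ξ => φ (f ξ)) :=
  (hφ.comp_contDiffOn hf).congr fun _ hy => radialExtension_comp φ f hy

theorem const (c : ℝ) : SphereContDiff n (fun _ => c) :=
  contDiffOn_const (c := c).congr fun y (hy : y ≠ 0) => by simp [radialExtension, hy]

theorem coord (i : Fin 5) : SphereContDiff n (fun ξ => (ξ : R5) i) := by
  refine ContDiffOn.congr (f := fun y : R5 => ‖y‖⁻¹ * y i) ?_
    fun y hy => radialExtension_coord i hy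
  intro y (hy : y ≠ 0)
  apply ContDiffAt.contDiffWithinAt
  exact ((contDiffAt_norm ℝ hy).inv (norm_ne_zero_iff.mpr hy)).mul (by fun_prop)

theorem coordGrad (i : Fin 5) (hf : SphereContDiff n f) (h : m + 1 ≤ n) :
    SphereContDiff m (coordGrad i f) := by
  refine ContDiffOn.congr (f := fun y : R5 => ‖y‖ *
    fderiv ℝ (radialExtension f) y (EuclideanSpace.single i 1)) ?_
    fun y hy => radialExtension_coordGrad i f hy
  intro y (hy : y ≠ 0)
  apply ContDiffAt.contDiffWithinAt
  exact (contDiffAt_norm ℝ hy).mul (((hf.contDiffAt hy).fderiv_right h).clm_apply contDiffAt_const)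

end SphereContDiff

theorem coordGrad_add {f g : S4 → ℝ} (hf : SphereContDiff 1 f) (hg : SphereContDiff 1 g)
    (i : Fin 5) (ξ : S4) :
    coordGrad i (fun ξ => f ξ + g ξ) ξ = coordGrad i f ξ + coordGrad i g ξ := by
  have h0 := coe_S4_ne_zero ξ
  rw [coordGrad, radialExtension_add,
    fderiv_fun_add (hf.differentiableAt h0) (hg.differentiableAt h0)]
  rfl

theorem coordGrad_mul {f g : S4 → ℝ} (hf : SphereContDiff 1 f) (hg : SphereContDiff 1 g)
    (i : Fin 5) (ξ : S4) :
    coordGrad i (fun ξ => f ξ * g ξ) ξ = coordGrad i f ξ * g ξ + f ξ * coordGrad i g ξ := by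
  have h0 := coe_S4_ne_zero ξ
  rw [coordGrad, radialExtension_mul,
    fderiv_fun_mul (hf.differentiableAt h0) (hg.differentiableAt h0)]
  simp [coordGrad, radialExtension_coe]
  ring

theorem coordGrad_comp {f : S4 → ℝ} {φ : ℝ → ℝ} (hf : SphereContDiff 1 f)
    (hφ : ContDiff ℝ 1 φ) (i : Fin 5) (ξ : S4) :
    coordGrad i (fun ξ => φ (f ξ)) ξ = deriv φ (f ξ) * coordGrad i f ξ := by
  have h0 := coe_S4_ne_zero ξ
  have he : radialExtension (fun ξ => φ (f ξ)) =ᶠ[nhds (ξ : R5)] φ ∘ radialExtension f := by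
    filter_upwards [isOpen_compl_singleton.mem_nhds h0] with y hy
    exact radialExtension_comp φ f hy
  rw [coordGrad, he.fderiv_eq, fderiv_comp _ (hφ.differentiable one_ne_zero _)
    (hf.differentiableAt h0), radialExtension_coe]
  rw [ContinuousLinearMap.comp_apply, fderiv_eq_smul_deriv, smul_eq_mul, mul_comm]
  rfl

theorem fderiv_norm_single {y : R5} (hy : y ≠ 0) (i : Fin 5) :
    fderiv ℝ (fun z : R5 => ‖z‖) y (EuclideanSpace.single i 1) = ‖y‖⁻¹ * y i := by
  have h1 : (fun z : R5 => ‖z‖) = fun z => √(‖z‖ ^ 2) := by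
    ext z; simp
  have h2 : ‖y‖ ≠ 0 := norm_ne_zero_iff.mpr hy
  have h3 := (hasStrictFDerivAt_norm_sq y).hasFDerivAt.sqrt (by positivity)
  rw [h1, h3.fderiv]
  simp [EuclideanSpace.inner_single_right]
  field_simp

/-- The fields `coordGrad i` come from vectors tangent to the sphere. -/
theorem sum_coord_mul_coordGrad {f : S4 → ℝ} (hf : SphereContDiff 1 f) (ξ : S4) :
    ∑ i, (ξ : R5) i * coordGrad i f ξ = 0 := by
  have h0 := coe_S4_ne_zero ξ
  have h1 : ∑ i, (ξ : R5) i * coordGrad i f ξ = fderiv ℝ (radialExtension f) (ξ : R5) ξ := by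
    simp only [coordGrad]
    conv_rhs => arg 2; rw [← (EuclideanSpace.basisFun (Fin 5) ℝ).sum_repr (ξ : R5)]
    simp [map_sum]
  rw [h1]
  -- Euler's relation: the radial derivative is that of t ↦ F(tξ) at t = 1, and this function is
  -- constant.
  have h2 : HasDerivAt (fun t : ℝ => radialExtension f (t • (ξ : R5)))
      (fderiv ℝ (radialExtension f) (ξ : R5) ξ) 1 := by
    have := (hf.differentiableAt h0).hasFDerivAt
    have h3 : HasDerivAt (fun t : ℝ => t • (ξ : R5)) (ξ : R5) 1 := by
      simpa using (hasDerivAt_id (1 : ℝ)).smul_const (ξ : R5)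
    rw [← one_smul ℝ (ξ : R5)] at this
    simpa [Function.comp_def] using this.comp_hasDerivAt (1 : ℝ) h3
  have h4 : HasDerivAt (fun t : ℝ => radialExtension f (t • (ξ : R5))) 0 1 := by
    refine (hasDerivAt_const (1 : ℝ) (radialExtension f (ξ : R5))).congr_of_eventuallyEq ?_
    filter_upwards [lt_mem_nhds (zero_lt_one : (0 : ℝ) < 1)] with t ht
    exact radialExtension_smul f ht _
  exact h2.unique h4

theorem coordGrad_coord (i j : Fin 5) (ξ : S4) :
    coordGrad i (fun ξ => (ξ : R5) j) ξ =
      (if i = j then 1 else 0) - (ξ : R5) i * (ξ : R5) j := by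
  have h0 := coe_S4_ne_zero ξ
  have hn := norm_coe_S4 ξ
  have he : radialExtension (fun ξ => (ξ : R5) j) =ᶠ[nhds (ξ : R5)] fun y => ‖y‖⁻¹ * y j := by
    filter_upwards [isOpen_compl_singleton.mem_nhds h0] with y hy
    exact radialExtension_coord j hy
  have hN : DifferentiableAt ℝ (fun y : R5 => ‖y‖) (ξ : R5) :=
    (contDiffAt_norm ℝ h0 (n := 1)).differentiableAt one_ne_zero
  have hJ : HasFDerivAt (fun y : R5 => y j) (EuclideanSpace.proj j : R5 →L[ℝ] ℝ) (ξ : R5) :=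
    (EuclideanSpace.proj j : R5 →L[ℝ] ℝ).hasFDerivAt
  have hI : HasFDerivAt (fun y : R5 => ‖y‖⁻¹) _ (ξ : R5) :=
    (hasDerivAt_inv (norm_ne_zero_iff.mpr h0)).comp_hasFDerivAt (ξ : R5) hN.hasFDerivAt
  rw [coordGrad, he.fderiv_eq, (hI.fun_mul hJ).fderiv]
  have := fderiv_norm_single h0 i
  simp [hn] at this ⊢
  rw [this]
  simp [eq_comm (a := i)]
  ring

/-- Iterated `coordGrad` in terms of the Euclidean derivatives of the radial extension. -/
theorem coordGrad_coordGrad {f : S4 → ℝ} (hf : SphereContDiff 2 f) (i j : Fin 5) (ξ : S4) :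
    coordGrad i (coordGrad j f) ξ = (ξ : R5) i * coordGrad j f ξ +
      fderiv ℝ (fderiv ℝ (radialExtension f)) (ξ : R5) (EuclideanSpace.single i 1)
        (EuclideanSpace.single j 1) := by
  have h0 := coe_S4_ne_zero ξ
  have hn := norm_coe_S4 ξ
  have he : radialExtension (coordGrad j f) =ᶠ[nhds (ξ : R5)] fun y =>
      ‖y‖ * fderiv ℝ (radialExtension f) y (EuclideanSpace.single j 1) := by
    filter_upwards [isOpen_compl_singleton.mem_nhds h0] with y hy
    exact radialExtension_coordGrad j f hy
  have hN : DifferentiableAt ℝ (fun y : R5 => ‖y‖) (ξ : R5) :=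
    (contDiffAt_norm ℝ h0 (n := 1)).differentiableAt one_ne_zero
  have hD : DifferentiableAt ℝ (fderiv ℝ (radialExtension f)) (ξ : R5) :=
    ((hf.contDiffAt h0).fderiv_right (m := 1) (by norm_num)).differentiableAt one_ne_zero
  rw [coordGrad, he.fderiv_eq, fderiv_fun_mul hN (hD.clm_apply (differentiableAt_const _)),
    fderiv_clm_apply hD (differentiableAt_const _)]
  have := fderiv_norm_single h0 i
  simp [hn] at this ⊢
  rw [this, coordGrad]
  ring

/-- The Euclidean Hessian is symmetric, so the commutator comes only from differentiating the factor
`‖y‖` in the extension of `coordGrad`. -/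
theorem coordGrad_comm {f : S4 → ℝ} (hf : SphereContDiff 2 f) (i j : Fin 5) (ξ : S4) :
    coordGrad i (coordGrad j f) ξ = coordGrad j (coordGrad i f) ξ +
      (ξ : R5) i * coordGrad j f ξ - (ξ : R5) j * coordGrad i f ξ := by
  rw [coordGrad_coordGrad hf, coordGrad_coordGrad hf]
  have hs : IsSymmSndFDerivAt ℝ (radialExtension f) (ξ : R5) :=
    (hf.contDiffAt (coe_S4_ne_zero ξ)).isSymmSndFDerivAt (by simp)
  rw [hs.eq]
  ring

/-- The first-order corrections in `coordGrad_coordGrad` sum to a radial derivative, which vanishes.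
-/
theorem sphereLaplacian_eq_sum {f : S4 → ℝ} (hf : SphereContDiff 2 f) (ξ : S4) :
    sphereLaplacian f ξ = ∑ j, coordGrad j (coordGrad j f) ξ := by
  simp only [coordGrad_coordGrad hf]
  rw [Finset.sum_add_distrib, sum_coord_mul_coordGrad (hf.mono (by norm_num)), zero_add,
    sphereLaplacian, InnerProductSpace.laplacian_eq_iteratedFDeriv_orthonormalBasis _
      (EuclideanSpace.basisFun (Fin 5) ℝ)]
  simp [iteratedFDeriv_two_apply]

/-! ### Polar coordinates and the divergence theorem -/

/-- Integration in polar coordinates of a product of a radial function and a function on the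
sphere. -/
theorem integral_radial_mul_radialExtension (w : ℝ → ℝ) (h : S4 → ℝ) :
    ∫ y : R5, w ‖y‖ * radialExtension h y =
      (∫ ξ, h ξ ∂(volume : Measure R5).toSphere) *
        ∫ r : Ioi (0 : ℝ), w r ∂(Measure.volumeIoiPow 4) := by
  have hfr : Module.finrank ℝ R5 - 1 = 4 := by simp
  have hmp := (volume : Measure R5).measurePreserving_homeomorphUnitSphereProd
  rw [hfr] at hmp
  have hsub := integral_subtype_comap (μ := (volume : Measure R5))
    (measurableSet_singleton (0 : R5)).compl (fun y : R5 => w ‖y‖ * radialExtension h y)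
  rw [restrict_compl_singleton] at hsub
  rw [← hsub, ← integral_prod_mul, ← hmp.integral_comp (Homeomorph.measurableEmbedding _)]
  congr 1
  ext ⟨y, hy⟩
  have hy' : y ≠ 0 := hy
  rw [mul_comm]
  have hp : (homeomorphUnitSphereProd R5 ⟨y, hy⟩).1 =
      ⟨‖y‖⁻¹ • y, by simp [norm_smul, norm_ne_zero_iff.mpr hy']⟩ := by
    ext1
    simp
  simp only [homeomorphUnitSphereProd_apply_snd_coe, radialExtension, dif_neg hy', hp]

/-- A smooth radial cutoff, supported in an annulus around the origin. -/
theorem exists_radial_cutoff : ∃ φ : ℝ → ℝ, ContDiff ℝ ∞ φ ∧ (∀ t, 0 ≤ φ t) ∧ φ 1 = 1 ∧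
    HasCompactSupport (fun y : R5 => φ (‖y‖ ^ 2)) ∧
    tsupport (fun y : R5 => φ (‖y‖ ^ 2)) ⊆ {0}ᶜ := by
  let φ : ContDiffBump (1 : ℝ) := ⟨1 / 4, 1 / 2, by norm_num, by norm_num⟩
  have hsupp : tsupport (fun y : R5 => φ (‖y‖ ^ 2)) ⊆ 
      (fun y => ‖y‖ ^ 2) ⁻¹' Icc (1 / 2) (3 / 2) := by
    refine closure_minimal ?_ (isClosed_Icc.preimage (f := fun y : R5 => ‖y‖ ^ 2) (by fun_prop))
    intro y hy
    have h1 : ‖y‖ ^ 2 ∈ Function.support φ := hy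
    rw [φ.support_eq, Metric.mem_ball, Real.dist_eq, abs_lt] at h1
    have h2 : φ.rOut = 1 / 2 := rfl
    rw [h2] at h1
    exact ⟨by linarith [h1.1], by linarith [h1.2]⟩
  refine ⟨φ, φ.contDiff, fun t => φ.nonneg, φ.one_of_mem_closedBall ?_, ?_, ?_⟩
  · exact Metric.mem_closedBall_self φ.rIn_pos.le
  · refine HasCompactSupport.of_support_subset_isCompact (isCompact_closedBall (0 : R5) 2) ?_
    intro y hy
    have := (hsupp (subset_closure hy)).2
    rw [mem_closedBall_zero_iff]
    nlinarith [norm_nonneg y]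
  · intro y hy h0
    have := (hsupp hy).1
    rw [mem_singleton_iff.mp h0] at this
    norm_num at this

/-- The divergence theorem for the fields `coordGrad i`, up to universal constants. -/
theorem exists_integral_coordGrad : ∃ a b : ℝ, a ≠ 0 ∧
    ∀ (i : Fin 5) (f : S4 → ℝ), SphereContDiff 1 f →
      a * ∫ ξ, coordGrad i f ξ ∂(volume : Measure R5).toSphere +
        b * ∫ ξ, (ξ : R5) i * f ξ ∂(volume : Measure R5).toSphere = 0 := by
  obtain ⟨φ, hφ, hφ0, hφ1, hcs, hsupp⟩ := exists_radial_cutoff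
  have hη : ContDiff ℝ ∞ (fun y : R5 => φ (‖y‖ ^ 2)) := hφ.comp (contDiff_norm_sq ℝ)
  have key : ∀ g : R5 → ℝ, ContinuousOn g {0}ᶜ → ∀ χ : R5 → ℝ, Continuous χ →
      tsupport χ ⊆ tsupport (fun y : R5 => φ (‖y‖ ^ 2)) →
      Continuous (fun y => g y * χ y) ∧ HasCompactSupport (fun y => g y * χ y) := by
    intro g hg χ hχ hs
    have hc : HasCompactSupport χ := hcs.mono' (subset_closure.trans hs)
    refine ⟨?_, hc.mul_left⟩
    refine ContinuousOn.continuous_of_tsupport_subset (s := {0}ᶜ) (hg.mul hχ.continuousOn)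
      isOpen_compl_singleton ?_
    exact (tsupport_mul_subset_right).trans (hs.trans hsupp)
  have hint : ∀ g : R5 → ℝ, ContinuousOn g {0}ᶜ → ∀ χ : R5 → ℝ, Continuous χ →
      tsupport χ ⊆ tsupport (fun y : R5 => φ (‖y‖ ^ 2)) → Integrable (fun y => g y * χ y) :=
    fun g hg χ hχ hs => (key g hg χ hχ hs).1.integrable_of_hasCompactSupport (key g hg χ hχ hs).2
  have hdη : ∀ (i : Fin 5) (y : R5), fderiv ℝ (fun y : R5 => φ (‖y‖ ^ 2)) y
      (EuclideanSpace.single i 1) = deriv φ (‖y‖ ^ 2) * (2 * y i) := by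
    intro i y
    have h1 := (hφ.differentiable (by simp) (‖y‖ ^ 2)).hasDerivAt.comp_hasFDerivAt y
      (hasStrictFDerivAt_norm_sq y).hasFDerivAt
    have h2 := h1.fderiv
    simp only [Function.comp_def] at h2
    rw [h2]
    simp [EuclideanSpace.inner_single_right]
  -- With r = ‖y‖, ∂_i F is r⁻¹ times the extension of X_i f, while ∂_i φ(r²) = 2r φ'(r²) · (y_i/r);
  -- these are the two radial weights.
  refine ⟨∫ r : Ioi (0 : ℝ), φ ((r : ℝ) ^ 2) * (r : ℝ)⁻¹ ∂(Measure.volumeIoiPow 4),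
    ∫ r : Ioi (0 : ℝ), deriv φ ((r : ℝ) ^ 2) * (2 * (r : ℝ)) ∂(Measure.volumeIoiPow 4), ?_, ?_⟩
  · intro h0
    have h1 := integral_radial_mul_radialExtension (fun r => φ (r ^ 2) * r⁻¹) (fun _ => 1)
    rw [h0, mul_zero] at h1
    have h2 := key (fun y => ‖y‖⁻¹) (continuousOn_id.norm.inv₀ fun y hy => norm_ne_zero_iff.mpr hy)
      _ hη.continuous subset_rfl
    have h3 := h2.1.integral_pos_of_hasCompactSupport_nonneg_nonzero h2.2 (μ := volume)
      (fun y => mul_nonneg (by positivity) (hφ0 _)) (x := EuclideanSpace.single 0 1)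
      (by simp [hφ1])
    rw [← h1] at h3
    refine h3.ne ?_
    congr 1
    ext y
    by_cases hy : y = 0
    · simp [hy, radialExtension]
    · simp [hy, radialExtension, mul_comm]
  · intro i f hf
    have hF : ContinuousOn (radialExtension f) {0}ᶜ := ContDiffOn.continuousOn hf
    have hF' : ContinuousOn (fun y => fderiv ℝ (radialExtension f) y (EuclideanSpace.single i 1))
        {0}ᶜ :=
      (ContDiffOn.continuousOn_fderiv_of_isOpen hf isOpen_compl_singleton le_rfl).clm_apply
        continuousOn_const
    have hη' : Continuous fun y => fderiv ℝ (fun y : R5 => φ (‖y‖ ^ 2)) y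
        (EuclideanSpace.single i 1) :=
      (hη.continuous_fderiv (by simp)).clm_apply continuous_const
    have hsη' : tsupport (fun y => fderiv ℝ (fun y : R5 => φ (‖y‖ ^ 2)) y
        (EuclideanSpace.single i 1)) ⊆ tsupport (fun y : R5 => φ (‖y‖ ^ 2)) :=
      tsupport_fderiv_apply_subset ℝ _
    -- The cutoff vanishes near the origin, the only place where the extension may fail to be
    -- differentiable.
    have hibp := integral_mul_fderiv_eq_neg_fderiv_mul_of_integrable (μ := (volume : Measure R5))
      (f := radialExtension f) (g := fun y : R5 => φ (‖y‖ ^ 2)) (v := EuclideanSpace.single i 1)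
      (hint _ hF' _ hη.continuous subset_rfl) (hint _ hF _ hη' hsη')
      (hint _ hF _ hη.continuous subset_rfl)
      (fun y hy => hf.differentiableAt (hsupp hy)) (fun y _ => hη.differentiable (by simp) y)
    have h1 := integral_radial_mul_radialExtension (fun r => φ (r ^ 2) * r⁻¹) (coordGrad i f)
    have h2 := integral_radial_mul_radialExtension (fun r => deriv φ (r ^ 2) * (2 * r))
      (fun ξ => (ξ : R5) i * f ξ)
    rw [mul_comm, ← h1, mul_comm (∫ r : Ioi (0 : ℝ), _ ∂(Measure.volumeIoiPow 4)), ← h2,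
      add_eq_zero_iff_neg_eq]
    have h3 : ∀ y : R5, φ (‖y‖ ^ 2) * ‖y‖⁻¹ * radialExtension (coordGrad i f) y =
        fderiv ℝ (radialExtension f) y (EuclideanSpace.single i 1) * φ (‖y‖ ^ 2) := by
      intro y
      by_cases hy : y = 0
      · have h0 : (0 : R5) ∉ tsupport (fun y : R5 => φ (‖y‖ ^ 2)) := fun h => hsupp h rfl
        have := image_eq_zero_of_notMem_tsupport h0
        rw [hy, this]
        simp
      · rw [radialExtension_coordGrad i f hy]
        have : ‖y‖ ≠ 0 := norm_ne_zero_iff.mpr hy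
        field_simp
    have h4 : ∀ y : R5, deriv φ (‖y‖ ^ 2) * (2 * ‖y‖) *
        radialExtension (fun ξ => (ξ : R5) i * f ξ) y = radialExtension f y *
          fderiv ℝ (fun y : R5 => φ (‖y‖ ^ 2)) y (EuclideanSpace.single i 1) := by
      intro y
      rw [hdη]
      by_cases hy : y = 0
      · simp [hy]
      · rw [radialExtension_mul]
        beta_reduce
        rw [radialExtension_coord i hy]
        have : ‖y‖ ≠ 0 := norm_ne_zero_iff.mpr hy
        field_simp
    simp only [h3, h4, hibp]

theorem sum_coord_sq (ξ : S4) : ∑ i, (ξ : R5) i * (ξ : R5) i = 1 := by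
  have := EuclideanSpace.real_norm_sq_eq (ξ : R5)
  rw [norm_coe_S4] at this
  simp only [← sq]
  linarith

theorem SphereContDiff.integrable_toSphere {f : S4 → ℝ} (hf : SphereContDiff 0 f) :
    Integrable f (volume : Measure R5).toSphere :=
  hf.continuous.integrable_of_hasCompactSupport (HasCompactSupport.of_compactSpace f)

/-- The divergence theorem on the sphere for the fields `coordGrad i`. -/
theorem integral_coordGrad_toSphere {f : S4 → ℝ} (hf : SphereContDiff 1 f) (i : Fin 5) :
    ∫ ξ, coordGrad i f ξ ∂(volume : Measure R5).toSphere =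
      4 * ∫ ξ, (ξ : R5) i * f ξ ∂(volume : Measure R5).toSphere := by
  obtain ⟨a, b, ha, h⟩ := exists_integral_coordGrad
  have hc : ∀ j : Fin 5, SphereContDiff 0 (fun ξ : S4 => (ξ : R5) j * (ξ : R5) j) :=
    fun j => (SphereContDiff.coord j).mul (SphereContDiff.coord j)
  -- The radial integrals need not be computed: taking f = ξ_j and summing over j gives 4a + b = 0,
  -- because ∑ X_j ξ_j = 5 - 1 and ∑ ξ_j² = 1.
  have h1 : ∑ j : Fin 5, ∫ ξ, coordGrad j (fun ξ => (ξ : R5) j) ξ ∂(volume : Measure R5).toSphere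
      = 4 * (volume : Measure R5).toSphere.real univ := by
    rw [← integral_finsetSum]
    · have : ∀ ξ : S4, ∑ j, coordGrad j (fun ξ => (ξ : R5) j) ξ = 4 := by
        intro ξ
        simp only [coordGrad_coord, if_true, Finset.sum_sub_distrib, sum_coord_sq]
        norm_num
      simp [this, mul_comm]
    · intro j _
      exact ((SphereContDiff.coord (n := 1) j).coordGrad j (by simp)).integrable_toSphere
  have h2 : ∑ j : Fin 5, ∫ ξ, (ξ : R5) j * (ξ : R5) j ∂(volume : Measure R5).toSphere
      = (volume : Measure R5).toSphere.real univ := by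
    rw [← integral_finsetSum _ fun j _ => (hc j).integrable_toSphere]
    simp [sum_coord_sq]
  have h3 := Finset.sum_congr (rfl : (Finset.univ : Finset (Fin 5)) = _)
    fun j _ => h j _ (SphereContDiff.coord j)
  rw [Finset.sum_add_distrib, ← Finset.mul_sum, ← Finset.mul_sum, h1, h2] at h3
  have hpos : (volume : Measure R5).toSphere.real univ ≠ 0 := by
    rw [measureReal_ne_zero_iff, Ne, Measure.measure_univ_eq_zero]
    exact (volume : Measure R5).toSphere_ne_zero
  have hb : b = -(4 * a) := by
    apply mul_right_cancel₀ hpos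
    simp only [Finset.sum_const_zero] at h3
    linear_combination h3
  have h4 := h i f hf
  rw [hb] at h4
  apply mul_left_cancel₀ ha
  linear_combination h4

instance : IsProbabilityMeasure sphereMeasure := by
  have : NeZero (volume : Measure R5).toSphere := ⟨(volume : Measure R5).toSphere_ne_zero⟩
  exact inferInstanceAs (IsProbabilityMeasure
    (((volume : Measure R5).toSphere univ)⁻¹ • (volume : Measure R5).toSphere))

/-- The divergence theorem on the sphere for the fields `coordGrad i`. -/
theorem integral_coordGrad {f : S4 → ℝ} (hf : SphereContDiff 1 f) (i : Fin 5) :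
    ∫ ξ, coordGrad i f ξ ∂sphereMeasure = 4 * ∫ ξ, (ξ : R5) i * f ξ ∂sphereMeasure := by
  rw [sphereMeasure, integral_smul_measure, integral_smul_measure, integral_coordGrad_toSphere hf]
  simp only [smul_eq_mul]
  ring

/-! ### Green's identity and the Laplacian -/

namespace SphereContDiff

variable {n m : ℕ∞ω} {f g : S4 → ℝ}

theorem integrable (hf : SphereContDiff n f) : Integrable f sphereMeasure :=
  hf.continuous.integrable_of_hasCompactSupport (HasCompactSupport.of_compactSpace f)

theorem sub (hf : SphereContDiff n f) (hg : SphereContDiff n g) :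
    SphereContDiff n (fun ξ => f ξ - g ξ) := by
  convert hf.add ((const (-1)).mul hg) using 2
  ring

theorem sum {ι : Type*} (s : Finset ι) {F : ι → S4 → ℝ} (h : ∀ j ∈ s, SphereContDiff n (F j)) :
    SphereContDiff n (fun ξ => ∑ j ∈ s, F j ξ) := by
  classical
  induction s using Finset.induction_on with
  | empty => simpa using const (n := n) 0
  | insert a s ha ih =>
    simp only [Finset.sum_insert ha]
    exact (h a (by simp)).add (ih fun j hj => h j (by simp [hj]))

theorem sphereLaplacian (hf : SphereContDiff n f) (h : m + 1 + 1 ≤ n) :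
    SphereContDiff m (sphereLaplacian f) := by
  have h2 : SphereContDiff 2 f := hf.mono (le_trans (by
    rw [add_assoc, one_add_one_eq_two]; exact le_add_self) h)
  rw [show _root_.sphereLaplacian f = _ from funext (sphereLaplacian_eq_sum h2)]
  exact sum _ fun j _ => (hf.coordGrad j h).coordGrad j le_rfl

end SphereContDiff

theorem coordGrad_const (c : ℝ) (i : Fin 5) (ξ : S4) : coordGrad i (fun _ => c) ξ = 0 := by
  have he : radialExtension (fun _ => c) =ᶠ[nhds (ξ : R5)] fun _ => c := by
    filter_upwards [isOpen_compl_singleton.mem_nhds (coe_S4_ne_zero ξ)] with y hy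
    exact radialExtension_comp (fun _ => c) (fun _ => 0) hy
  rw [coordGrad, he.fderiv_eq]
  simp

theorem coordGrad_sub {f g : S4 → ℝ} (hf : SphereContDiff 1 f) (hg : SphereContDiff 1 g)
    (i : Fin 5) (ξ : S4) :
    coordGrad i (fun ξ => f ξ - g ξ) ξ = coordGrad i f ξ - coordGrad i g ξ := by
  have h := coordGrad_add (hf.sub hg) hg i ξ
  simp only [sub_add_cancel] at h
  linarith

theorem coordGrad_sum {ι : Type*} (s : Finset ι) {F : ι → S4 → ℝ}
    (h : ∀ j ∈ s, SphereContDiff 1 (F j)) (i : Fin 5) (ξ : S4) :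
    coordGrad i (fun ξ => ∑ j ∈ s, F j ξ) ξ = ∑ j ∈ s, coordGrad i (F j) ξ := by
  classical
  induction s using Finset.induction_on with
  | empty => simpa using coordGrad_const 0 i ξ
  | insert a s ha ih =>
    have hs : ∀ j ∈ s, SphereContDiff 1 (F j) := fun j hj => h j (by simp [hj])
    simp only [Finset.sum_insert ha]
    rw [coordGrad_add (h a (by simp)) (SphereContDiff.sum s hs), ih hs]

/-- Green's identity on the sphere. -/
theorem integral_mul_sphereLaplacian {f g : S4 → ℝ} (hf : SphereContDiff 1 f)
    (hg : SphereContDiff 2 g) :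
    ∫ ξ, f ξ * sphereLaplacian g ξ ∂sphereMeasure =
      -∫ ξ, ∑ j, coordGrad j f ξ * coordGrad j g ξ ∂sphereMeasure := by
  have hg1 : ∀ j, SphereContDiff 1 (coordGrad j g) := fun j => hg.coordGrad j (by norm_num)
  have hfg : ∀ j, SphereContDiff 1 (fun ξ => f ξ * coordGrad j g ξ) := fun j => hf.mul (hg1 j)
  have hL : SphereContDiff 0 (sphereLaplacian g) := hg.sphereLaplacian (by norm_num)
  -- The term 4ξ_j of the divergence theorem drops out after summation because ∇g is tangent.
  have h1 : ∑ j, ∫ ξ, coordGrad j (fun ξ => f ξ * coordGrad j g ξ) ξ ∂sphereMeasure = 0 := by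
    simp only [fun j => integral_coordGrad (hfg j) j]
    rw [← Finset.mul_sum, ← integral_finsetSum _
      fun j _ => ((SphereContDiff.coord j).mul (hfg j)).integrable]
    have : ∀ ξ : S4, ∑ j, (ξ : R5) j * (f ξ * coordGrad j g ξ) = 0 := by
      intro ξ
      simp only [mul_left_comm _ (f ξ)]
      rw [← Finset.mul_sum, sum_coord_mul_coordGrad (hg.mono (by norm_num)), mul_zero]
    simp [this]
  rw [← integral_finsetSum _ fun j _ => ((hfg j).coordGrad (m := 0) j (by simp)).integrable] at h1
  rw [eq_neg_iff_add_eq_zero, ← h1, ← integral_add]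
  · congr 1
    ext ξ
    simp only [fun j => coordGrad_mul hf (hg1 j) j ξ, Finset.sum_add_distrib]
    rw [sphereLaplacian_eq_sum hg, Finset.mul_sum, add_comm]
  · exact ((hf.mono (by simp)).mul hL).integrable
  · exact (SphereContDiff.sum (n := 0) _ fun j _ =>
      (hf.coordGrad j (by simp)).mul ((hg1 j).mono (by simp))).integrable

theorem integral_mul_sphereLaplacian_comm {f g : S4 → ℝ} (hf : SphereContDiff 2 f)
    (hg : SphereContDiff 2 g) :
    ∫ ξ, f ξ * sphereLaplacian g ξ ∂sphereMeasure =
      ∫ ξ, sphereLaplacian f ξ * g ξ ∂sphereMeasure := by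
  simp only [mul_comm (sphereLaplacian f _)]
  rw [integral_mul_sphereLaplacian (hf.mono (by norm_num)) hg,
    integral_mul_sphereLaplacian (hg.mono (by norm_num)) hf]
  simp only [mul_comm]

theorem sphereLaplacian_coord (i : Fin 5) (ξ : S4) :
    sphereLaplacian (fun ξ => (ξ : R5) i) ξ = -4 * (ξ : R5) i := by
  have hc : ∀ j : Fin 5, SphereContDiff 1 (fun ξ : S4 => (ξ : R5) j) := SphereContDiff.coord
  have h : ∀ j : Fin 5, coordGrad j (coordGrad j fun ξ => (ξ : R5) i) ξ =
      -(ξ : R5) i + 2 * (ξ : R5) i * ((ξ : R5) j * (ξ : R5) j)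
        - (if j = i then (ξ : R5) j else 0) := by
    intro j
    rw [show (coordGrad j fun ξ => (ξ : R5) i) = _ from funext (coordGrad_coord j i),
      coordGrad_sub (SphereContDiff.const _) ((hc j).mul (hc i)), coordGrad_const,
      coordGrad_mul (hc j) (hc i), coordGrad_coord, coordGrad_coord, if_pos rfl]
    split_ifs <;> ring
  rw [sphereLaplacian_eq_sum (SphereContDiff.coord i)]
  simp only [h, Finset.sum_sub_distrib, Finset.sum_add_distrib, ← Finset.mul_sum, sum_coord_sq]
  simp
  ring

/-! ### Conformal fields and the Paneitz operator -/

/-- The commutator of the Laplacian with the conformal field `coordGrad i`. -/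
theorem sphereLaplacian_coordGrad {f : S4 → ℝ} (hf : SphereContDiff 3 f) (i : Fin 5) (ξ : S4) :
    sphereLaplacian (coordGrad i f) ξ = coordGrad i (sphereLaplacian f) ξ +
      2 * coordGrad i f ξ - 2 * (ξ : R5) i * sphereLaplacian f ξ := by
  have hf2 : SphereContDiff 2 f := hf.mono (by norm_num)
  have hc : ∀ j : Fin 5, SphereContDiff 1 (fun ξ : S4 => (ξ : R5) j) := SphereContDiff.coord
  have h2 : ∀ j, SphereContDiff 2 (coordGrad j f) := fun j => hf.coordGrad j (by norm_num)
  have h1 : ∀ j, SphereContDiff 1 (coordGrad j f) := fun j => (h2 j).mono (by norm_num)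
  have h11 : ∀ j k, SphereContDiff 1 (coordGrad j (coordGrad k f)) :=
    fun j k => (h2 k).coordGrad j (by norm_num)
  have h : ∀ j, coordGrad j (coordGrad j (coordGrad i f)) ξ =
      coordGrad i (coordGrad j (coordGrad j f)) ξ
        - 2 * (ξ : R5) i * coordGrad j (coordGrad j f) ξ + coordGrad i f ξ
        - 2 * coordGrad i f ξ * ((ξ : R5) j * (ξ : R5) j)
        + 2 * ((ξ : R5) j * coordGrad j (coordGrad i f) ξ)
        + 2 * (ξ : R5) i * ((ξ : R5) j * coordGrad j f ξ)
        - (if j = i then coordGrad j f ξ else 0) := by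
    intro j
    rw [show coordGrad j (coordGrad i f) = _ from funext (coordGrad_comm hf2 j i),
      coordGrad_sub ((h11 i j).add ((hc j).mul (h1 i))) ((hc i).mul (h1 j)),
      coordGrad_add (h11 i j) ((hc j).mul (h1 i)), coordGrad_mul (hc j) (h1 i),
      coordGrad_mul (hc i) (h1 j), coordGrad_comm (h2 j) j i, coordGrad_coord, coordGrad_coord,
      if_pos rfl, coordGrad_comm hf2 j i]
    split_ifs <;> ring
  rw [sphereLaplacian_eq_sum (h2 i), sphereLaplacian_eq_sum hf2,
    show sphereLaplacian f = _ from funext (sphereLaplacian_eq_sum hf2),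
    coordGrad_sum _ fun j _ => h11 j j]
  -- The coefficient of X_i f is 5 - 2 - 1 = 2: five copies, then ∑ ξ_j² = 1, then the Kronecker
  -- term.
  simp only [h, Finset.sum_sub_distrib, Finset.sum_add_distrib, ← Finset.mul_sum, sum_coord_sq,
    sum_coord_mul_coordGrad (h1 i), sum_coord_mul_coordGrad (hf.mono (by norm_num : (1 : ℕ∞ω) ≤ 3))]
  simp
  ring

/-- Conformal invariance of the Paneitz energy, in infinitesimal form. -/
theorem integral_paneitz_mul_coordGrad {u : S4 → ℝ} (hu : SphereContDiff 4 u) (i : Fin 5) :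
    ∫ ξ, paneitz u ξ * coordGrad i u ξ ∂sphereMeasure = 0 := by
  have hv : SphereContDiff 2 (sphereLaplacian u) := hu.sphereLaplacian (by norm_num)
  have hv1 : SphereContDiff 1 (sphereLaplacian u) := hv.mono (by norm_num)
  have hw : SphereContDiff 2 (coordGrad i u) := hu.coordGrad i (by norm_num)
  have hvv : SphereContDiff 0 (sphereLaplacian (sphereLaplacian u)) :=
    hv.sphereLaplacian (by norm_num)
  have hw0 : SphereContDiff 0 (coordGrad i u) := hw.mono (by simp)
  have hv0 : SphereContDiff 0 (sphereLaplacian u) := hv.mono (by simp)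
  have hx : SphereContDiff 0 (fun ξ : S4 => (ξ : R5) i) := SphereContDiff.coord i
  have hX : SphereContDiff 0 (coordGrad i (sphereLaplacian u)) := hv.coordGrad i (by norm_num)
  -- With v = Δu, the divergence theorem for v² gives ∫ v X_i v = 2 ∫ ξ_i v². This cancels the -2ξ_i
  -- v term of the commutator, leaving ∫ Δv X_i u = 2 ∫ v X_i u, exactly what the -2Δ in P₄ removes.
  have hsq := integral_coordGrad (hv1.mul hv1) i
  simp only [coordGrad_mul hv1 hv1] at hsq
  have hsym := integral_mul_sphereLaplacian_comm hv hw
  simp only [sphereLaplacian_coordGrad (hu.mono (by norm_num : (3 : ℕ∞ω) ≤ 4)) i] at hsym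
  have e1 : ∀ ξ : S4, paneitz u ξ * coordGrad i u ξ =
      sphereLaplacian (sphereLaplacian u) ξ * coordGrad i u ξ
        - 2 * (sphereLaplacian u ξ * coordGrad i u ξ) := fun ξ => by rw [paneitz]; ring
  have e2 : ∀ ξ : S4, sphereLaplacian u ξ * (coordGrad i (sphereLaplacian u) ξ +
      2 * coordGrad i u ξ - 2 * (ξ : R5) i * sphereLaplacian u ξ) =
      sphereLaplacian u ξ * coordGrad i (sphereLaplacian u) ξ
        + 2 * (sphereLaplacian u ξ * coordGrad i u ξ)
        - 2 * ((ξ : R5) i * (sphereLaplacian u ξ * sphereLaplacian u ξ)) := fun ξ => by ring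
  have e3 : ∀ ξ : S4, coordGrad i (sphereLaplacian u) ξ * sphereLaplacian u ξ +
      sphereLaplacian u ξ * coordGrad i (sphereLaplacian u) ξ =
      2 * (sphereLaplacian u ξ * coordGrad i (sphereLaplacian u) ξ) := fun ξ => by ring
  have i1 := (hvv.mul hw0).integrable
  have i2 := (hv0.mul hw0).integrable
  have i3 := (hv0.mul hX).integrable
  have i4 := (hx.mul (hv0.mul hv0)).integrable
  simp only [e2] at hsym
  rw [integral_sub (i3.fun_add (i2.const_mul 2)) (i4.const_mul 2), integral_add i3 (i2.const_mul 2),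
    integral_const_mul, integral_const_mul] at hsym
  simp only [e3] at hsq
  rw [integral_const_mul] at hsq
  simp only [e1]
  rw [integral_sub i1 (i2.const_mul 2), integral_const_mul]
  linarith

theorem integral_coord (i : Fin 5) : ∫ ξ, (ξ : R5) i ∂sphereMeasure = 0 := by
  have h := integral_coordGrad (SphereContDiff.const 1) i
  simp only [coordGrad_const, integral_zero, mul_one] at h
  linarith

/-- Self-adjointness moves P₄ onto ξ_i, where Δ acts as -4 and so P₄ as 16 + 8 = 24. -/
theorem integral_paneitz_mul_coord {u : S4 → ℝ} (hu : SphereContDiff 4 u) (i : Fin 5) :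
    ∫ ξ, paneitz u ξ * (ξ : R5) i ∂sphereMeasure = 24 * ∫ ξ, u ξ * (ξ : R5) i ∂sphereMeasure := by
  have hv : SphereContDiff 2 (sphereLaplacian u) := hu.sphereLaplacian (by norm_num)
  have hvv : SphereContDiff 0 (sphereLaplacian (sphereLaplacian u)) :=
    hv.sphereLaplacian (by norm_num)
  have hx : SphereContDiff 0 (fun ξ : S4 => (ξ : R5) i) := SphereContDiff.coord i
  have h1 := integral_mul_sphereLaplacian_comm hv (SphereContDiff.coord i)
  have h2 := integral_mul_sphereLaplacian_comm (hu.mono (by norm_num)) (SphereContDiff.coord i)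
  simp only [sphereLaplacian_coord, mul_left_comm _ (-4 : ℝ), integral_const_mul] at h1 h2
  simp only [paneitz, sub_mul, mul_assoc]
  rw [integral_sub (hvv.mul hx).integrable
    (((hv.mono (by simp)).mul hx).integrable.const_mul 2), integral_const_mul]
  linarith

/-! ### The two test functions -/

theorem proposition1p5 (α : ℝ) (hα : 0 < α) (hα1 : α ≠ 1) (u : S4 → ℝ)
    (hu : IsQCurvatureSolution α u) :
    ∀ i : Fin 5,
      ∫ ξ, Real.exp (4 * u ξ) * (ξ : R5) i ∂sphereMeasure = 0 ∧
      ∫ ξ, u ξ * (ξ : R5) i ∂sphereMeasure = 0 := by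
  intro i
  have hu4 : SphereContDiff 4 u := hu.contMDiff.sphereContDiff
  have hu1 : SphereContDiff 1 u := hu4.mono (by norm_num)
  have hφ : ContDiff ℝ 1 (fun t : ℝ => Real.exp (4 * t)) := by fun_prop
  have hE : SphereContDiff 1 (fun ξ => Real.exp (4 * u ξ)) := hu1.comp hφ
  have hE0 : SphereContDiff 0 (fun ξ => Real.exp (4 * u ξ)) := hE.mono (by simp)
  have hv : SphereContDiff 2 (sphereLaplacian u) := hu4.sphereLaplacian (by norm_num)
  have hP : SphereContDiff 0 (paneitz u) :=
    (hv.sphereLaplacian (by norm_num)).sub ((SphereContDiff.const 2).mul (hv.mono (by simp)))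
  have hI : 0 < ∫ η, Real.exp (4 * u η) ∂sphereMeasure := integral_exp_pos hE.integrable
  set I := ∫ η, Real.exp (4 * u η) ∂sphereMeasure with hIdef
  have hgradE : ∫ ξ, Real.exp (4 * u ξ) * coordGrad i u ξ ∂sphereMeasure =
      ∫ ξ, Real.exp (4 * u ξ) * (ξ : R5) i ∂sphereMeasure := by
    have h := integral_coordGrad hE i
    have hd : ∀ t : ℝ, deriv (fun t : ℝ => Real.exp (4 * t)) t = 4 * Real.exp (4 * t) := by
      intro t
      have := ((hasDerivAt_id t).const_mul 4).exp.deriv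
      simp only [id, mul_one] at this
      rw [this, mul_comm]
    simp only [coordGrad_comp hu1 hφ, hd, mul_assoc, integral_const_mul] at h
    simp only [mul_comm _ (Real.exp _)] at h
    linarith
  have hgradu := integral_coordGrad hu1 i
  simp only [mul_comm _ (u _)] at hgradu
  -- Integrate the equation against a test function.
  have test : ∀ g : S4 → ℝ, SphereContDiff 0 g →
      α * ∫ ξ, paneitz u ξ * g ξ ∂sphereMeasure + 6 * ∫ ξ, g ξ ∂sphereMeasure
        - 6 / I * ∫ ξ, Real.exp (4 * u ξ) * g ξ ∂sphereMeasure = 0 := by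
    intro g hg
    rw [← integral_const_mul, ← integral_const_mul, ← integral_const_mul,
      ← integral_add ((hP.mul hg).integrable.const_mul _) (hg.integrable.const_mul _),
      ← integral_sub (((hP.mul hg).integrable.const_mul _).fun_add (hg.integrable.const_mul _))
        ((hE0.mul hg).integrable.const_mul _)]
    rw [← integral_zero S4 ℝ (μ := sphereMeasure)]
    congr 1
    ext ξ
    have := hu.equation ξ
    rw [← hIdef] at this
    linear_combination g ξ * this
  have t1 := test _ (hu4.coordGrad i (by norm_num))
  have t2 := test _ (SphereContDiff.coord i)
  rw [integral_paneitz_mul_coordGrad hu4, hgradE, hgradu] at t1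
  rw [integral_paneitz_mul_coord hu4, integral_coord] at t2
  have hzero : ∫ ξ, u ξ * (ξ : R5) i ∂sphereMeasure = 0 := by
    -- Both tests contain the same exponential term; subtracting them eliminates it and leaves 24(1
    -- - α) ∫ u ξ_i = 0.
    have h : (1 - α) * ∫ ξ, u ξ * (ξ : R5) i ∂sphereMeasure = 0 := by linarith
    exact (mul_eq_zero.mp h).resolve_left (sub_ne_zero.mpr hα1.symm)
  refine ⟨?_, hzero⟩
  rw [hzero] at t1
  have h : 6 / I * ∫ ξ, Real.exp (4 * u ξ) * (ξ : R5) i ∂sphereMeasure = 0 := by linarith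
  exact (mul_eq_zero.mp h).resolve_left (by positivity)
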